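/- Let $G$ be a group. A finite sequence $(g_1,\dots,g_k)$ of elements of $G$ is an irredundant generating sequence if it generates $G$ and, for every $j$, the sequence obtained by removing $g_j$ does not generate $G$. Let $m(G)$ be the maximum length of an irredundant generating sequence of $G$. The group $G$ satisfies the replacement property if for every irredundant generating sequence $(g_1,\dots,g_k)$ of length $k=m(G)$ and every $g\in G$ with $g\neq 1$ there is an index $j$ such that $(g_1,\dots,g_{j-1},g,g_{j+1},\dots,g_k)$ generates $G$. Theorem. Let $p$ be a prime with $p\equiv 1 \pmod 8$ and let $G=\mathrm{PSL}(2,p)=\mathrm{SL}(2,\mathbb{F}_p)/Z(\mathrm{SL}(2,\mathbb{F}_p))$. If $m(G)=3$, then $G$ fails the replacement property. Moreover, there are $i,\zeta\in\mathbb{F}_p$ with $i^2=-1$ and $\zeta^2=2$, and for any such $i,\zeta$ the following holds. Put $$s=\tfrac{1}{3}(2i+\zeta),\quad r=\Bigl(i+\tfrac{1}{\zeta}\Bigr)s,\quad u=\tfrac{1}{3}(2i-\zeta),\quad t=\Bigl(i-\tfrac{1}{\zeta}\Bigr)u .$$ The matrices $$W=\begin{pmatrix}0&-1\\1&0\end{pmatrix},\quad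 A=\begin{pmatrix}r&s\\s&-r\end{pmatrix},\quad B=\begin{pmatrix}t&u\\u&-t\end{pmatrix},\quad C=\begin{pmatrix}-i&0\\-1&i\end{pmatrix}$$ have determinant $1$. Let $w,a,b,c$ be their images in $G$. Then $w\neq 1$, the sequence $(wa,wb,wc)$ is an irredundant generating sequence of $G$, and $w$ can replace none of its entries: none of $(w,wb,wc)$, $(wa,w,wc)$, $(wa,wb,w)$ generates $G$. -/

import Mathlib

open scoped MatrixGroups

/-- The sequence `g` generates the group `G`. -/
def GeneratesGroup {G : Type*} [Group G] {k : ℕ} (g : Fin k → G) : Prop :=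
  Subgroup.closure (Set.range g) = ⊤

/-- The sequence `g` is an irredundant generating sequence of `G`: it generates `G`, and after the
removal of any single entry `g j` the remaining entries no longer generate `G`. -/
def IsIrredundantGenerating {G : Type*} [Group G] {k : ℕ} (g : Fin k → G) : Prop :=
  GeneratesGroup g ∧ ∀ j : Fin k, Subgroup.closure (g '' {l | l ≠ j}) ≠ ⊤

/-- `m(G)`: the maximum length of an irredundant generating sequence of `G`
(as an extended natural number, so that it is meaningful for every group). -/
noncomputable def maxIrredundantLength (G : Type*) [Group G] : ℕ∞ :=
  sSup {n : ℕ∞ | ∃ (k : ℕ) (g : Fin k → G), n = (k : ℕ∞) ∧ IsIrredundantGenerating g}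

/-- `x` can replace some entry of the sequence `g` so that the new sequence still generates `G`. -/
def CanReplaceSomeEntry {G : Type*} [Group G] {k : ℕ} (g : Fin k → G) (x : G) : Prop :=
  ∃ j : Fin k, GeneratesGroup (Function.update g j x)

/-- `G` satisfies the replacement property for the sequence `g`: every non-identity element
can replace some entry of `g`. -/
def SatisfiesReplacementFor {G : Type*} [Group G] {k : ℕ} (g : Fin k → G) : Prop :=
  ∀ x : G, x ≠ 1 → CanReplaceSomeEntry g x

/-- `G` satisfies the replacement property: it does so for every irredundant generating
sequence of length `m(G)`. -/
def SatisfiesReplacementProperty (G : Type*) [Group G] : Prop :=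
  ∀ (k : ℕ) (g : Fin k → G), (k : ℕ∞) = maxIrredundantLength G →
    IsIrredundantGenerating g → SatisfiesReplacementFor g

/-! The element `w` shares a proper subgroup with any two of the three entries. The triple `w, a, c`
satisfies relations of the symmetric group on four letters (`isOctahedralTriple`), so it normalizes
a set of three conjugates of `a`. The change of sign `ζ ↦ -ζ` turns `A` into `B`, so `w, b, c`
behave likewise. Finally `a` and `b` commute with `w`. Two normalizers and the centralizer of `w`
therefore witness both irredundancy and the failure of replacement (`not_generates_of_forall_mem`).

The work lies in generation. The relation `(wac)^3 = 1` puts `w` in the subgroup `H` generated by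
the entries, so `H` contains `w, a, b, c`. If `p` divides `|H|`, then `H` contains the image of a
transvection and fixes no point of the projective line, hence is everything
(`eq_top_of_char_dvd_card`).

If `p` does not divide `|H|`, every nontrivial element of `H` has exactly two fixed points on the
projective line over an algebraic closure. Klein's orbit count, with an element of order 4 and
cyclic and dihedral behaviour excluded, forces order 24 (`card_eq_twentyFour_of_coprime`). This
applies both to `H` and to its intersection with the normalizer attached to `a`, so the two agree;
but `b` lies outside that normalizer, by a trace computation. -/

/-! ### Orbit counting for finite groups whose nontrivial elements fix two points -/

/-- This is `1/n₁ + 1/n₂ + 1/n₃ = 1 + 2/N`, with `nᵢ` the stabilizer orders and `aᵢ` the orbit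
sizes. The bound `3 ≤ a₁` discards the dihedral solution `n₂ = n₃ = 2`, leaving only the type `(4,
2, 3)`. -/
theorem eq_twentyFour_of_orbit_equation {N n₁ n₂ n₃ a₁ a₂ a₃ : ℕ}
    (h₁ : n₁ * a₁ = N) (h₂ : n₂ * a₂ = N) (h₃ : n₃ * a₃ = N)
    (hn₂ : 2 ≤ n₂) (hn₃ : 2 ≤ n₃) (ha₁ : 3 ≤ a₁)
    (h4 : 4 ∣ n₁) (h : a₁ + a₂ + a₃ = N + 2) : N = 24 := by
  obtain ⟨m, rfl⟩ := h4
  have hm : 1 ≤ m := by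
    rcases Nat.eq_zero_or_pos m with rfl | hm
    · have ha₂ : a₂ = 0 := by
        rcases Nat.mul_eq_zero.mp (h₂.trans (by simp [← h₁] : N = 0)) with h | h <;> omega
      have ha₃ : a₃ = 0 := by
        rcases Nat.mul_eq_zero.mp (h₃.trans (by simp [← h₁] : N = 0)) with h | h <;> omega
      simp at h₁
      omega
    · exact hm
  have key₁ : 4 * a₁ ≤ N := by
    rw [← h₁]; exact Nat.mul_le_mul_right _ (by omega)
  have le₂ : ∀ k, k ≤ n₂ → k * a₂ ≤ N := fun k hk => h₂ ▸ Nat.mul_le_mul_right _ hk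
  have le₃ : ∀ k, k ≤ n₃ → k * a₃ ≤ N := fun k hk => h₃ ▸ Nat.mul_le_mul_right _ hk
  have main : ∀ a b : ℕ, 2 * a = N → 3 * b = N → a₁ + a + b = N + 2 → N = 24 := by
    intro a b ha hb hs
    -- Here `6 * a₁ = N + 12`, whereas `m ≥ 2` would give `8 * a₁ ≤ N`.
    have hm1 : m = 1 := by
      by_contra hne
      have : 4 * 2 * a₁ ≤ 4 * m * a₁ := Nat.mul_le_mul_right _ (by omega)
      omega
    subst hm1
    omega
  rcases Nat.lt_or_ge n₂ 3 with h2 | h2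
  · obtain rfl : n₂ = 2 := by omega
    rcases Nat.lt_or_ge n₃ 4 with h3 | h3
    · obtain rfl | rfl : n₃ = 2 ∨ n₃ = 3 := by omega
      · omega
      · exact main a₂ a₃ h₂ h₃ h
    · have := le₃ 4 h3
      omega
  · rcases Nat.lt_or_ge n₃ 3 with h3 | h3
    · obtain rfl : n₃ = 2 := by omega
      rcases Nat.lt_or_ge n₂ 4 with h2' | h2'
      · obtain rfl : n₂ = 3 := by omega
        exact main a₃ a₂ h₃ h₂ (by omega)
      · have := le₂ 4 h2'
        omega
    · have := le₂ 3 h2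
      have := le₃ 3 h3
      omega

namespace MulAction

variable {H Y : Type*} [Group H] [MulAction H Y]

/-- The points with a nontrivial stabilizer. -/
def nonfreePoints (H Y : Type*) [Group H] [MulAction H Y] : SubMulAction H Y where
  carrier := {y | ∃ h : H, h ≠ 1 ∧ h • y = y}
  smul_mem' := by
    rintro g y ⟨h, hne, hy⟩
    refine ⟨g * h * g⁻¹, by simpa using hne, ?_⟩
    simp [mul_smul, hy]

theorem finite_nonfreePoints [Finite H] (hfix : ∀ h : H, h ≠ 1 → (fixedBy Y h).ncard = 2) :
    Finite (nonfreePoints H Y) := by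
  have : ((nonfreePoints H Y : SubMulAction H Y) : Set Y) ⊆
      ⋃ h : {h : H // h ≠ 1}, fixedBy Y h.1 := by
    rintro y ⟨h, hne, hy⟩
    exact Set.mem_iUnion.mpr ⟨⟨h, hne⟩, hy⟩
  refine Set.Finite.subset (Set.finite_iUnion fun h => ?_) this
  exact Set.finite_of_ncard_ne_zero (by rw [hfix _ h.2]; decide)

theorem card_fixedBy_nonfreePoints (hfix : ∀ h : H, h ≠ 1 → (fixedBy Y h).ncard = 2)
    {h : H} (hne : h ≠ 1) : Nat.card (fixedBy (nonfreePoints H Y) h) = 2 := by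
  rw [← hfix h hne, ← Nat.card_coe_set_eq]
  refine Nat.card_congr ⟨fun y => ⟨y.1.1, ?_⟩, fun y => ⟨⟨y.1, h, hne, y.2⟩, ?_⟩, ?_, ?_⟩
  · exact congrArg Subtype.val y.2
  · exact Subtype.ext y.2
  · intro y; rfl
  · intro y; rfl

theorem card_stabilizer_out (X : Type*) [MulAction H X] (x : X) :
    Nat.card (stabilizer H (Quotient.out (Quotient.mk'' x : orbitRel.Quotient H X))) =
      Nat.card (stabilizer H x) :=
  Nat.card_congr (stabilizerEquivStabilizerOfOrbitRel (Quotient.mk_out (s := orbitRel H X) x)).toEquiv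

/-- Burnside's lemma: the identity fixes every point, and each of the other elements contributes 2.
-/
theorem card_nonfreePoints_add [Finite H]
    (hfix : ∀ h : H, h ≠ 1 → (fixedBy Y h).ncard = 2) :
    Nat.card (nonfreePoints H Y) + 2 * (Nat.card H - 1) =
      Nat.card (orbitRel.Quotient H (nonfreePoints H Y)) * Nat.card H := by
  classical
  have := Fintype.ofFinite H
  have := finite_nonfreePoints hfix
  have := Fintype.ofFinite (nonfreePoints H Y)
  have hb := sum_card_fixedBy_eq_card_orbits_mul_card_group H (nonfreePoints H Y)
  rw [Nat.card_eq_fintype_card, Nat.card_eq_fintype_card, Nat.card_eq_fintype_card, ← hb,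
    ← Finset.add_sum_erase _ _ (Finset.mem_univ (1 : H))]
  congr 1
  · refine Fintype.card_congr ⟨fun x => ⟨x, one_smul _ _⟩, fun x => x.1, fun _ => rfl, fun _ => rfl⟩
  · rw [Finset.sum_congr rfl (g := fun _ => 2)]
    · simp [Finset.card_erase_of_mem, mul_comm]
    · intro h hh
      rw [← Nat.card_eq_fintype_card, card_fixedBy_nonfreePoints hfix (Finset.ne_of_mem_erase hh)]

/-- A finite group whose nontrivial elements have exactly two fixed points has order 24 as soon as
it contains an element of order 4 and no point is fixed by all squares. -/
theorem card_eq_twentyFour [Finite H] (hfix : ∀ h : H, h ≠ 1 → (fixedBy Y h).ncard = 2)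
    (hsq : ∀ y : Y, ∃ h : H, h ^ 2 • y ≠ y) {x : H} (hx : orderOf x = 4) :
    Nat.card H = 24 := by
  classical
  have := Fintype.ofFinite H
  have hXfin := finite_nonfreePoints hfix
  have := Fintype.ofFinite (nonfreePoints H Y)
  set X := nonfreePoints H Y with hX
  set Ω := orbitRel.Quotient H X with hΩ
  set N := Nat.card H with hN
  have hx1 : x ≠ 1 := by rintro rfl; simp at hx
  have hN4 : 4 ≤ N := hx ▸ orderOf_le_card
  have hburn : Nat.card X + 2 * (N - 1) = Nat.card Ω * N := card_nonfreePoints_add hfix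
  let n : Ω → ℕ := fun ω => Nat.card (stabilizer H ω.out)
  let a : Ω → ℕ := fun ω => (stabilizer H ω.out).index
  have hna : ∀ ω, n ω * a ω = N := fun ω => Subgroup.card_mul_index _
  have hn2 : ∀ ω, 2 ≤ n ω := by
    intro ω
    obtain ⟨h, hne, hy⟩ := ω.out.2
    by_contra hlt
    have h1 : Nat.card (stabilizer H ω.out) = 1 := by
      have : 0 < Nat.card (stabilizer H ω.out) := Nat.card_pos
      change ¬ 2 ≤ Nat.card (stabilizer H ω.out) at hlt
      omega
    have := Subgroup.eq_bot_of_card_eq _ h1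
    have hmem : h ∈ stabilizer H ω.out := Subtype.ext hy
    rw [this] at hmem
    exact hne hmem
  -- A subgroup of index 2 contains all squares, so `hsq` excludes index 2 as well as index 1. This
  -- is why `hsq` speaks of squares.
  have ha3 : ∀ ω, 3 ≤ a ω := by
    intro ω
    obtain ⟨h, hh⟩ := hsq ω.out.1
    have hnot : h ^ 2 ∉ stabilizer H ω.out := fun hm => hh (congrArg Subtype.val hm)
    have h0 : (stabilizer H ω.out).index ≠ 0 := Subgroup.index_ne_zero_of_finite
    have h1 : (stabilizer H ω.out).index ≠ 1 := fun h1 => by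
      rw [Subgroup.index_eq_one] at h1
      exact hnot (h1 ▸ Subgroup.mem_top _)
    have h2 : (stabilizer H ω.out).index ≠ 2 := fun h2 => hnot (Subgroup.sq_mem_of_index_two h2 h)
    change 3 ≤ (stabilizer H ω.out).index
    omega
  have hsum : Nat.card X = ∑ ω : Ω, a ω := by
    rw [Nat.card_eq_fintype_card, card_eq_sum_card_group_div_card_stabilizer H X]
    refine Finset.sum_congr rfl fun ω _ => ?_
    rw [← Nat.card_eq_fintype_card, ← Nat.card_eq_fintype_card]
    exact Nat.div_eq_of_eq_mul_right Nat.card_pos (hna ω).symm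
  obtain ⟨ω₀, hω₀⟩ : ∃ ω, 4 ∣ n ω := by
    have hne : (fixedBy Y x).Nonempty :=
      Set.nonempty_of_ncard_ne_zero (by rw [hfix x hx1]; decide)
    obtain ⟨y, hy⟩ := hne
    let y' : X := ⟨y, x, hx1, hy⟩
    refine ⟨Quotient.mk'' y', ?_⟩
    change 4 ∣ Nat.card _
    rw [card_stabilizer_out, ← hx]
    have hmem : x ∈ stabilizer H y' := Subtype.ext hy
    have := orderOf_dvd_natCard (⟨x, hmem⟩ : stabilizer H y')
    rwa [Subgroup.orderOf_mk] at this
  -- Nontrivial stabilizers give at most `N / 2` points per orbit, which excludes four or more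
  -- orbits; at least three points per orbit excludes two or fewer.
  have hk : Nat.card Ω = 3 := by
    have hle : 2 * Nat.card X ≤ Nat.card Ω * N := by
      rw [hsum, Finset.mul_sum, Nat.card_eq_fintype_card, ← Finset.card_univ, ← smul_eq_mul]
      refine Finset.sum_le_card_nsmul _ _ _ fun ω _ => ?_
      rw [← hna ω]
      exact Nat.mul_le_mul_right _ (hn2 ω)
    have hge : 3 * Nat.card Ω ≤ Nat.card X := by
      rw [hsum, Nat.card_eq_fintype_card, ← Finset.card_univ, mul_comm, ← smul_eq_mul]
      exact Finset.card_nsmul_le_sum _ _ _ fun ω _ => ha3 ω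
    have hlt : Nat.card Ω < 4 := by
      by_contra hcon
      have : 4 * N ≤ Nat.card Ω * N := Nat.mul_le_mul_right _ (by omega)
      omega
    interval_cases h : Nat.card Ω <;> omega
  let e : Fin 3 ≃ Ω := (Finite.equivFinOfCardEq hk).symm
  have hs3 : Nat.card X = a (e 0) + a (e 1) + a (e 2) := by
    rw [hsum, ← e.sum_comp, Fin.sum_univ_three]
  have htot : a (e 0) + a (e 1) + a (e 2) = N + 2 := by
    rw [hk] at hburn
    omega
  obtain ⟨j, rfl⟩ := e.surjective ω₀
  fin_cases j
  · exact eq_twentyFour_of_orbit_equation (hna (e 0)) (hna (e 1)) (hna (e 2)) (hn2 _) (hn2 _)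
      (ha3 _) hω₀ htot
  · exact eq_twentyFour_of_orbit_equation (hna (e 1)) (hna (e 0)) (hna (e 2)) (hn2 _) (hn2 _)
      (ha3 _) hω₀ (by omega)
  · exact eq_twentyFour_of_orbit_equation (hna (e 2)) (hna (e 0)) (hna (e 1)) (hn2 _) (hn2 _)
      (ha3 _) hω₀ (by omega)

end MulAction

/-! ### Traces and element orders in PSL(2, F), and the Möbius action -/

section

open Matrix

namespace Matrix.SpecialLinearGroup

variable {F : Type*} [Field F]

theorem mem_center_fin_two_iff {X : SL(2, F)} :
    X ∈ Subgroup.center SL(2, F) ↔ X = 1 ∨ X = -1 := by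
  rw [mem_center_iff]
  constructor
  · rintro ⟨r, hr, hX⟩
    rw [Fintype.card_fin, sq_eq_one_iff] at hr
    rcases hr with rfl | rfl
    · left; ext i j; rw [← hX]; simp
    · right; ext i j; rw [← hX]; fin_cases i <;> fin_cases j <;> simp
  · rintro (rfl | rfl)
    · exact ⟨1, by simp, by simp⟩
    · exact ⟨-1, by simp, by ext i j; fin_cases i <;> fin_cases j <;> simp⟩

theorem mk_eq_mk_iff {X Y : SL(2, F)} :
    (QuotientGroup.mk X : PSL(2, F)) = QuotientGroup.mk Y ↔ X = Y ∨ X = -Y := by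
  rw [eq_comm, QuotientGroup.eq, mem_center_fin_two_iff, inv_mul_eq_one, inv_mul_eq_iff_eq_mul,
    mul_neg, mul_one]
  exact or_congr_left eq_comm

theorem mk_eq_one_iff {X : SL(2, F)} : (QuotientGroup.mk X : PSL(2, F)) = 1 ↔ X = 1 ∨ X = -1 :=
  mk_eq_mk_iff (Y := 1)

theorem mk_neg (X : SL(2, F)) : (QuotientGroup.mk (-X) : PSL(2, F)) = QuotientGroup.mk X :=
  mk_eq_mk_iff.mpr (.inr rfl)

theorem trace_eq_or_of_mk_eq {X Y : SL(2, F)}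
    (h : (QuotientGroup.mk X : PSL(2, F)) = QuotientGroup.mk Y) :
    trace (X : Matrix (Fin 2) (Fin 2) F) = trace (Y : Matrix (Fin 2) (Fin 2) F) ∨
      trace (X : Matrix (Fin 2) (Fin 2) F) = -trace (Y : Matrix (Fin 2) (Fin 2) F) := by
  rcases mk_eq_mk_iff.mp h with rfl | rfl
  · exact .inl rfl
  · exact .inr (by simp)

/-- Cayley–Hamilton in determinant 1; it lets the orders 2, 3 and 4 in PSL be read off the trace. -/
theorem sq_eq_trace_smul_sub_one (X : SL(2, F)) :
    (X : Matrix (Fin 2) (Fin 2) F) ^ 2 =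
      trace (X : Matrix (Fin 2) (Fin 2) F) • (X : Matrix (Fin 2) (Fin 2) F) - 1 := by
  have hd := X.det_coe
  rw [det_fin_two] at hd
  ext i j
  fin_cases i <;> fin_cases j <;>
    simp [sq, Matrix.mul_apply, Fin.sum_univ_two, trace_fin_two] <;>
    first | ring1 | linear_combination (-1) * hd

theorem mk_sq_eq_one {X : SL(2, F)} (h : trace (X : Matrix (Fin 2) (Fin 2) F) = 0) :
    (QuotientGroup.mk X : PSL(2, F)) ^ 2 = 1 := by
  rw [← QuotientGroup.mk_pow, mk_eq_one_iff]
  right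
  apply Subtype.ext
  rw [coe_pow, sq_eq_trace_smul_sub_one, h]
  simp

theorem mk_pow_three_eq_one {X : SL(2, F)} (h : trace (X : Matrix (Fin 2) (Fin 2) F) ^ 2 = 1) :
    (QuotientGroup.mk X : PSL(2, F)) ^ 3 = 1 := by
  have h2 := sq_eq_trace_smul_sub_one X
  rw [← QuotientGroup.mk_pow, mk_eq_one_iff]
  set τ := trace (X : Matrix (Fin 2) (Fin 2) F)
  have h3 : (X : Matrix (Fin 2) (Fin 2) F) ^ 3 = (-τ) • 1 := by
    rw [pow_succ, h2, sub_mul, smul_mul_assoc, ← sq, h2, smul_sub, smul_smul, ← sq, h]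
    simp
  rw [sq_eq_one_iff] at h
  rcases h with h | h
  · right; apply Subtype.ext; rw [coe_pow, h3, h]; simp
  · left; apply Subtype.ext; rw [coe_pow, h3, h]; simp

theorem mk_pow_four_eq_one {X : SL(2, F)} (h : trace (X : Matrix (Fin 2) (Fin 2) F) ^ 2 = 2) :
    (QuotientGroup.mk X : PSL(2, F)) ^ 4 = 1 := by
  rw [show 4 = 2 * 2 from rfl, pow_mul, ← QuotientGroup.mk_pow]
  apply mk_sq_eq_one
  rw [coe_pow, sq_eq_trace_smul_sub_one, trace_sub, trace_smul, smul_eq_mul, ← sq, h, trace_one]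
  simp

section ProjectiveLine

variable (K : Type*) [Field K] [DecidableEq K] [Algebra F K]

/-- The action of `PSL(2, F)` by Möbius transformations on the projective line over an extension
field. -/
noncomputable def moebius : PSL(2, F) →* Equiv.Perm (OnePoint K) :=
  QuotientGroup.lift _
    ((MulAction.toPermHom (GL (Fin 2) K) (OnePoint K)).comp (toGL.comp (map (algebraMap F K)))) <| by
      intro X hX
      rw [MonoidHom.mem_ker]
      ext z
      rcases mem_center_fin_two_iff.mp hX with rfl | rfl <;> cases z <;>
        simp [OnePoint.smul_infty_eq_ite, OnePoint.smul_some_eq_ite]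

variable {K}

theorem moebius_mk (X : SL(2, F)) (y : OnePoint K) :
    moebius K (QuotientGroup.mk X) y = toGL (map (algebraMap F K) X) • y := rfl

end ProjectiveLine

end Matrix.SpecialLinearGroup

/-! ### Fixed points on the projective line -/

namespace Matrix.GeneralLinearGroup

variable {K : Type*} [Field K] [DecidableEq K]

theorem smul_coe_eq_self_iff {g : GL (Fin 2) K} {z : K} :
    g • (z : OnePoint K) = z ↔ g 1 0 * z ^ 2 + (g 1 1 - g 0 0) * z - g 0 1 = 0 := by
  rw [← fixpointPolynomial_aeval_eq_zero_iff]
  simp [fixpointPolynomial]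

theorem ncard_fixedBy_eq_two [IsAlgClosed K] [NeZero (2 : K)] {g : GL (Fin 2) K}
    (hg : discrim (g 1 0) (g 1 1 - g 0 0) (-g 0 1) ≠ 0) :
    (MulAction.fixedBy (OnePoint K) g).ncard = 2 := by
  rw [Set.ncard_eq_two]
  by_cases hc : g 1 0 = 0
  · have hd : g 1 1 - g 0 0 ≠ 0 := by
      intro h
      simp [discrim, hc, h] at hg
    refine ⟨OnePoint.infty, ((g 0 1 / (g 1 1 - g 0 0) : K) : OnePoint K),
      OnePoint.infty_ne_coe _, ?_⟩
    ext z
    cases z with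
    | infty => simp [MulAction.mem_fixedBy, OnePoint.smul_infty_eq_self_iff, hc]
    | coe z =>
      rw [MulAction.mem_fixedBy, smul_coe_eq_self_iff, hc]
      simp only [Set.mem_insert_iff, OnePoint.coe_ne_infty, Set.mem_singleton_iff,
        OnePoint.coe_eq_coe, false_or, eq_div_iff hd]
      constructor <;> intro h <;> linear_combination h
  · obtain ⟨s, hs⟩ := IsAlgClosed.exists_eq_mul_self (discrim (g 1 0) (g 1 1 - g 0 0) (-g 0 1))
    have hs0 : s ≠ 0 := by rintro rfl; simp [hs] at hg
    have h2 : (2 : K) ≠ 0 := NeZero.ne _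
    refine ⟨(((-(g 1 1 - g 0 0) + s) / (2 * g 1 0) : K) : OnePoint K),
      (((-(g 1 1 - g 0 0) - s) / (2 * g 1 0) : K) : OnePoint K), ?_, ?_⟩
    · rw [Ne, OnePoint.coe_eq_coe, div_left_inj' (mul_ne_zero h2 hc)]
      intro h
      exact mul_ne_zero h2 hs0 (by linear_combination h)
    · ext z
      cases z with
      | infty => simp [MulAction.mem_fixedBy, OnePoint.smul_infty_eq_self_iff, hc]
      | coe z =>
        rw [MulAction.mem_fixedBy, smul_coe_eq_self_iff]
        simp only [Set.mem_insert_iff, Set.mem_singleton_iff, OnePoint.coe_eq_coe]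
        rw [← quadratic_eq_zero_iff hc hs]
        constructor <;> intro h <;> linear_combination h

/-- Two matrices fixing a common point of the projective line have a singular commutator. -/
theorem det_commutator_eq_zero_of_smul_eq {g h : GL (Fin 2) K} {y : OnePoint K} (hg : g • y = y)
    (hh : h • y = y) : Matrix.det (g.1 * h.1 - h.1 * g.1) = 0 := by
  -- A common fixed point is a common eigenvector, which the commutator kills.
  cases y with
  | infty =>
    rw [OnePoint.smul_infty_eq_self_iff] at hg hh
    rw [det_fin_two]
    simp only [sub_apply, Matrix.mul_apply, Fin.sum_univ_two, hg, hh]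
    ring
  | coe z =>
    rw [smul_coe_eq_self_iff] at hg hh
    have hg' : g 0 1 = g 1 0 * z ^ 2 + (g 1 1 - g 0 0) * z := by linear_combination -hg
    have hh' : h 0 1 = h 1 0 * z ^ 2 + (h 1 1 - h 0 0) * z := by linear_combination -hh
    rw [det_fin_two]
    simp only [sub_apply, Matrix.mul_apply, Fin.sum_univ_two, hg', hh']
    ring

end Matrix.GeneralLinearGroup

/-! ### Subgroups of order prime to p -/

namespace Matrix.SpecialLinearGroup

variable {p : ℕ} [Fact p.Prime]

theorem sub_smul_one_pow_char (X : Matrix (Fin 2) (Fin 2) (ZMod p)) (ε : ZMod p) :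
    (X - ε • (1 : Matrix (Fin 2) (Fin 2) (ZMod p))) ^ p = X ^ p - ε • 1 := by
  rw [sub_pow_char_of_commute p ((Commute.one_right X).smul_right ε), smul_pow, one_pow,
    ZMod.pow_card]

theorem pow_char_eq_of_trace_eq {X : SL(2, ZMod p)} {ε : ZMod p} (hε : ε ^ 2 = 1)
    (h : trace (X : Matrix (Fin 2) (Fin 2) (ZMod p)) = 2 * ε) :
    (X : Matrix (Fin 2) (Fin 2) (ZMod p)) ^ p = ε • 1 := by
  rw [← sub_eq_zero, ← sub_smul_one_pow_char]
  have h2 : ((X : Matrix (Fin 2) (Fin 2) (ZMod p)) - ε • 1) ^ 2 = 0 := by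
    have hX := sq_eq_trace_smul_sub_one X
    rw [h] at hX
    have : ((X : Matrix (Fin 2) (Fin 2) (ZMod p)) - ε • 1) ^ 2 =
        (X : Matrix (Fin 2) (Fin 2) (ZMod p)) ^ 2 - (2 * ε) • (X : Matrix (Fin 2) (Fin 2) (ZMod p))
          + ε ^ 2 • 1 := by
      simp only [sq, sub_mul, mul_sub, smul_mul_assoc, mul_smul_comm, one_mul, mul_one]
      module
    rw [this, hX, hε]
    simp
  exact pow_eq_zero_of_le (Fact.out : p.Prime).two_le h2

theorem trace_eq_of_pow_char_eq {X : SL(2, ZMod p)} {ε : ZMod p} (hε : ε ^ 2 = 1)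
    (h : (X : Matrix (Fin 2) (Fin 2) (ZMod p)) ^ p = ε • 1) :
    trace (X : Matrix (Fin 2) (Fin 2) (ZMod p)) = 2 * ε := by
  have h0 : ((X : Matrix (Fin 2) (Fin 2) (ZMod p)) - ε • 1) ^ p = 0 := by
    rw [sub_smul_one_pow_char, h, sub_self]
  have h1 := congrArg Matrix.det h0
  rw [det_pow, det_zero] at h1
  have h2 := eq_zero_of_pow_eq_zero h1
  have hd := X.det_coe
  rw [det_fin_two] at hd h2
  simp only [sub_apply, smul_apply, one_apply_eq, smul_eq_mul, mul_one, ne_eq, zero_ne_one,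
    one_ne_zero, not_false_eq_true, one_apply_ne, mul_zero, sub_zero] at h2
  rw [trace_fin_two]
  have : ε * (X 0 0 + X 1 1) = 2 := by linear_combination hd - h2 + hε
  linear_combination ε * this - (X 0 0 + X 1 1) * hε

/-- The discriminant of the fixed-point equation is `trace ^ 2 - 4`. Trace `±2` would make the
`p`-th power of `X` equal to `±1`, contradicting `hg` or `hcop`. -/
theorem ncard_fixedBy_moebius (hp2 : p ≠ 2) {K : Type*} [Field K] [DecidableEq K]
    [Algebra (ZMod p) K] [IsAlgClosed K] {g : PSL(2, ZMod p)} (hg : g ≠ 1)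
    (hcop : ¬ p ∣ orderOf g) : {y | moebius K g y = y}.ncard = 2 := by
  have hp := (Fact.out : p.Prime)
  induction g using QuotientGroup.induction_on with
  | H X =>
  have : NeZero (2 : ZMod p) := ⟨by
    intro h
    have : (p : ℕ) ∣ 2 := (ZMod.natCast_eq_zero_iff 2 p).mp (by exact_mod_cast h)
    exact hp2 ((Nat.prime_dvd_prime_iff_eq hp Nat.prime_two).mp this)⟩
  have hK : NeZero (2 : K) := ⟨by
    intro h
    refine NeZero.ne (2 : ZMod p) ((algebraMap (ZMod p) K).injective ?_)
    rw [map_zero, ← h]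
    exact map_ofNat _ 2⟩
  have htr : ∀ ε : ZMod p, ε = 1 ∨ ε = -1 →
      trace (X : Matrix (Fin 2) (Fin 2) (ZMod p)) ≠ 2 * ε := by
    intro ε hε h
    have h2 := pow_char_eq_of_trace_eq (sq_eq_one_iff.mpr hε) h
    have h3 : (QuotientGroup.mk X : PSL(2, ZMod p)) ^ p = 1 := by
      rw [← QuotientGroup.mk_pow, mk_eq_one_iff]
      rcases hε with rfl | rfl
      · left; apply Subtype.ext; rw [coe_pow, h2]; simp
      · right; apply Subtype.ext; rw [coe_pow, h2]; simp
    rcases (Nat.dvd_prime hp).mp (orderOf_dvd_of_pow_eq_one h3) with h4 | h4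
    · exact hg (orderOf_eq_one_iff.mp h4)
    · exact hcop h4.symm.dvd
  refine GeneralLinearGroup.ncard_fixedBy_eq_two
    (g := toGL (map (algebraMap (ZMod p) K) X)) ?_
  have hd := X.det_coe
  rw [det_fin_two] at hd
  have hdisc : discrim (X 1 0) (X 1 1 - X 0 0) (-X 0 1) ≠ 0 := by
    intro h
    have : (X 0 0 + X 1 1 - 2 * 1) * (X 0 0 + X 1 1 - 2 * -1) = 0 := by
      rw [discrim] at h
      linear_combination h + 4 * hd
    rcases mul_eq_zero.mp this with h | h
    · exact htr 1 (.inl rfl) (by rw [trace_fin_two]; linear_combination h)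
    · exact htr (-1) (.inr rfl) (by rw [trace_fin_two]; linear_combination h)
  intro h
  refine hdisc ((algebraMap (ZMod p) K).injective ?_)
  have h4 : algebraMap (ZMod p) K 4 = 4 := map_ofNat _ 4
  simpa [discrim, h4] using h

theorem card_eq_twentyFour_of_coprime (hp2 : p ≠ 2) {H : Subgroup PSL(2, ZMod p)}
    (hH : ¬ p ∣ Nat.card H) {X Y Z : SL(2, ZMod p)}
    (hX : (QuotientGroup.mk X : PSL(2, ZMod p)) ∈ H)
    (hY : (QuotientGroup.mk Y : PSL(2, ZMod p)) ∈ H)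
    (hZ : (QuotientGroup.mk Z : PSL(2, ZMod p)) ∈ H)
    (hord : orderOf (QuotientGroup.mk X : PSL(2, ZMod p)) = 4)
    (hYZ : Matrix.det ((Y ^ 2 : SL(2, ZMod p)) * (Z ^ 2 : SL(2, ZMod p)) -
      (Z ^ 2 : SL(2, ZMod p)) * (Y ^ 2 : SL(2, ZMod p)) : Matrix (Fin 2) (Fin 2) (ZMod p)) ≠ 0) :
    Nat.card H = 24 := by
  classical
  let K := AlgebraicClosure (ZMod p)
  let _ : MulAction H (OnePoint K) :=
    MulAction.compHom (OnePoint K) ((moebius K).comp H.subtype)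
  have hsmul : ∀ (h : H) (y : OnePoint K), h • y = moebius K h.1 y := fun _ _ => rfl
  have hord' : orderOf (⟨_, hX⟩ : H) = 4 := by rwa [Subgroup.orderOf_mk]
  refine MulAction.card_eq_twentyFour (Y := OnePoint K) ?_ ?_ hord'
  · intro h hne
    refine ncard_fixedBy_moebius hp2 (K := K) (g := h.1) (by simpa using hne) ?_
    intro hdvd
    exact hH (hdvd.trans (by rw [Subgroup.orderOf_coe]; exact orderOf_dvd_natCard h))
  · intro y
    by_contra! hcon
    have h1 := hcon ⟨_, hY⟩
    have h2 := hcon ⟨_, hZ⟩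
    rw [hsmul, Subgroup.coe_pow, ← QuotientGroup.mk_pow, moebius_mk] at h1 h2
    have h3 := GeneralLinearGroup.det_commutator_eq_zero_of_smul_eq h1 h2
    apply hYZ
    apply (algebraMap (ZMod p) K).injective
    rw [map_zero, ← h3, RingHom.map_det, map_sub, map_mul, map_mul]
    rfl

/-! ### Transvections and subgroups of order divisible by p -/

section Unipotent

variable {F : Type*} [Field F]

/-- The upper unitriangular matrix with off-diagonal entry `x`. -/
def upper (x : F) : SL(2, F) := ⟨!![1, x; 0, 1], by simp⟩

theorem coe_upper (x : F) : (upper x : Matrix (Fin 2) (Fin 2) F) = !![1, x; 0, 1] := rfl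

theorem upper_pow (x : F) (n : ℕ) : upper x ^ n = upper (n * x) := by
  induction n with
  | zero => apply Subtype.ext; simp [coe_upper, one_fin_two]
  | succ n ih =>
    rw [pow_succ, ih]
    apply Subtype.ext
    simp [coe_upper]
    ring

theorem eq_top_of_upper_mem {Γ : Subgroup SL(2, F)} (hU : ∀ x, upper x ∈ Γ) {h : SL(2, F)}
    (hh : h ∈ Γ) (hc : h 1 0 ≠ 0) : Γ = ⊤ := by
  have hd := h.det_coe
  rw [det_fin_two] at hd
  -- Bruhat decomposition: clearing the diagonal of `h` by upper unitriangular factors leaves `m`,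
  -- which conjugates upper transvections into lower ones.
  let m : SL(2, F) := ⟨!![0, -(h 1 0)⁻¹; h 1 0, 0], by simp [hc]⟩
  have hmc : (m : Matrix (Fin 2) (Fin 2) F) = !![0, -(h 1 0)⁻¹; h 1 0, 0] := rfl
  have hm : m ∈ Γ := by
    have : m = upper (-(h 0 0 / h 1 0)) * h * upper (-(h 1 1 / h 1 0)) := by
      apply Subtype.ext
      rw [coe_mul, coe_mul, hmc, coe_upper, coe_upper]
      ext i j
      fin_cases i <;> fin_cases j <;>
        simp [Matrix.mul_apply, Fin.sum_univ_two, vecMul, dotProduct] <;> (try field_simp)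
      · ring
      · linear_combination hd
      · ring
    rw [this]
    exact Γ.mul_mem (Γ.mul_mem (hU _) hh) (hU _)
  rw [Subgroup.eq_top_iff']
  intro A
  refine SL2.transvection_induction (· ∈ Γ) ?_ (fun _ _ => Γ.mul_mem) A
  intro i j hij x
  fin_cases i <;> fin_cases j
  · exact absurd rfl hij
  · convert hU x
    ext i j
    fin_cases i <;> fin_cases j <;> simp [transvection_coe, coe_upper]
  · have : transvection hij x = m * upper (-x / h 1 0 ^ 2) * m⁻¹ := by
      apply Subtype.ext
      rw [coe_mul, coe_mul, coe_inv, hmc, coe_upper, adjugate_fin_two]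
      ext i j
      fin_cases i <;> fin_cases j <;> simp [transvection_coe, Matrix.mul_apply, hc]
      field_simp
    change transvection hij x ∈ Γ
    rw [this]
    exact Γ.mul_mem (Γ.mul_mem hm (hU _)) (Γ.inv_mem hm)
  · exact absurd rfl hij

theorem exists_conj_eq_upper {X : SL(2, F)} (hX : X ≠ 1)
    (htr : trace (X : Matrix (Fin 2) (Fin 2) F) = 2) :
    ∃ (P : SL(2, F)) (x : F), x ≠ 0 ∧ X * P = P * upper x := by
  have hd := X.det_coe
  rw [det_fin_two] at hd
  rw [trace_fin_two] at htr
  have h11 : X 1 1 = 2 - X 0 0 := by linear_combination htr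
  rw [h11] at hd
  by_cases hz : X 1 0 = 0
  · have h00 : X 0 0 = 1 := by
      have : (X 0 0 - 1) ^ 2 = 0 := by linear_combination -hd - X 0 1 * hz
      linear_combination eq_zero_of_pow_eq_zero this
    refine ⟨1, X 0 1, ?_, ?_⟩
    · intro h01
      apply hX
      ext i j
      fin_cases i <;> fin_cases j <;> simp [h00, h01, hz, h11]
      norm_num
    · rw [mul_one, one_mul]
      ext i j
      fin_cases i <;> fin_cases j <;> simp [h00, hz, h11, coe_upper]
      norm_num
  -- A Jordan basis: the second column is a multiple of the first basis vector, and the first column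
  -- is the image of that basis vector under `X - 1`.
  · refine ⟨⟨!![X 0 0 - 1, -(X 1 0)⁻¹; X 1 0, 0], by simp [hz]⟩, -(X 1 0)⁻¹, by simpa using hz, ?_⟩
    refine Subtype.ext ?_
    change (X : Matrix (Fin 2) (Fin 2) F) * !![X 0 0 - 1, -(X 1 0)⁻¹; X 1 0, 0] =
      !![X 0 0 - 1, -(X 1 0)⁻¹; X 1 0, 0] * !![1, -(X 1 0)⁻¹; 0, 1]
    ext i j
    fin_cases i <;> fin_cases j <;> simp [Matrix.mul_apply, Fin.sum_univ_two, h11, hz] <;>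
      (try field_simp)
    · linear_combination -hd
    · ring
    · ring

theorem det_commutator_conj (P Y Z : SL(2, F)) :
    Matrix.det (Y * Z - Z * Y : Matrix (Fin 2) (Fin 2) F) =
      Matrix.det ((P⁻¹ * Y * P : SL(2, F)) * (P⁻¹ * Z * P : SL(2, F)) -
        (P⁻¹ * Z * P : SL(2, F)) * (P⁻¹ * Y * P : SL(2, F)) : Matrix (Fin 2) (Fin 2) F) := by
  have h1 : P⁻¹ * Y * P * (P⁻¹ * Z * P) = P⁻¹ * (Y * Z) * P := by group
  have h2 : P⁻¹ * Z * P * (P⁻¹ * Y * P) = P⁻¹ * (Z * Y) * P := by group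
  rw [← coe_mul, ← coe_mul, ← coe_mul, ← coe_mul, h1, h2, coe_mul _ P, coe_mul _ P, coe_mul P⁻¹,
    coe_mul P⁻¹, ← sub_mul, ← mul_sub, det_mul, det_mul, det_coe, det_coe, one_mul, mul_one]

theorem det_commutator_eq_zero_of_triangular {Y Z : SL(2, F)} (hY : Y 1 0 = 0) (hZ : Z 1 0 = 0) :
    Matrix.det (Y * Z - Z * Y : Matrix (Fin 2) (Fin 2) F) = 0 := by
  rw [det_fin_two]
  simp only [sub_apply, Matrix.mul_apply, Fin.sum_univ_two, hY, hZ]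
  ring

/-- Over a prime field, a subgroup of `SL(2, F)` that contains a
transvection and does not fix a line is everything. -/
theorem eq_top_of_trace_eq_two {Γ : Subgroup SL(2, F)} {X Y Z : SL(2, F)}
    (hX : X ∈ Γ) (hX1 : X ≠ 1) (htr : trace (X : Matrix (Fin 2) (Fin 2) (F)) = 2)
    (hY : Y ∈ Γ) (hZ : Z ∈ Γ)
    (hYZ : Matrix.det (Y * Z - Z * Y : Matrix (Fin 2) (Fin 2) (F)) ≠ 0)
    (hF : ∀ x y : F, x ≠ 0 → ∃ n : ℕ, y = n * x) : Γ = ⊤ := by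
  obtain ⟨P, x, hx, hP⟩ := exists_conj_eq_upper hX1 htr
  obtain ⟨Γ', hmem⟩ : ∃ Γ' : Subgroup SL(2, F), ∀ g, g ∈ Γ' ↔ P * g * P⁻¹ ∈ Γ :=
    ⟨Γ.comap (MulAut.conj P).toMonoidHom, fun _ => Iff.rfl⟩
  have hcancel : ∀ g, P * (P⁻¹ * g * P) * P⁻¹ = g := fun g => by group
  have hconj : ∀ g ∈ Γ, P⁻¹ * g * P ∈ Γ' := fun g hg => by rwa [hmem, hcancel]
  have hU : upper x ∈ Γ' := by rwa [hmem, ← hP, mul_inv_cancel_right]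
  have hexists : ∃ h ∈ Γ', h 1 0 ≠ 0 := by
    by_contra! hcon
    rw [det_commutator_conj P] at hYZ
    exact hYZ (det_commutator_eq_zero_of_triangular (hcon _ (hconj Y hY)) (hcon _ (hconj Z hZ)))
  obtain ⟨h, hh, hc⟩ := hexists
  have htop : Γ' = ⊤ := by
    refine eq_top_of_upper_mem (fun y => ?_) hh hc
    obtain ⟨n, rfl⟩ := hF x y hx
    rw [← upper_pow]
    exact Γ'.pow_mem hU n
  rw [Subgroup.eq_top_iff']
  intro g
  rw [← hcancel g, ← hmem, htop]
  exact Subgroup.mem_top _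

end Unipotent

theorem eq_top_of_char_dvd_card {H : Subgroup PSL(2, ZMod p)}
    (hH : p ∣ Nat.card H) {Y Z : SL(2, ZMod p)}
    (hY : (QuotientGroup.mk Y : PSL(2, ZMod p)) ∈ H)
    (hZ : (QuotientGroup.mk Z : PSL(2, ZMod p)) ∈ H)
    (hYZ : Matrix.det (Y * Z - Z * Y : Matrix (Fin 2) (Fin 2) (ZMod p)) ≠ 0) : H = ⊤ := by
  obtain ⟨g, hg⟩ := exists_prime_orderOf_dvd_card' p hH
  obtain ⟨X, hX⟩ := QuotientGroup.mk_surjective g.1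
  have hordX : orderOf (QuotientGroup.mk X : PSL(2, ZMod p)) = p := by
    rw [hX, Subgroup.orderOf_coe, hg]
  have hXH : (QuotientGroup.mk X : PSL(2, ZMod p)) ∈ H := hX ▸ g.2
  have hXne : (QuotientGroup.mk X : PSL(2, ZMod p)) ≠ 1 := by
    intro h
    rw [h, orderOf_one] at hordX
    exact (Fact.out : p.Prime).one_lt.ne hordX
  have hXp : (QuotientGroup.mk X : PSL(2, ZMod p)) ^ p = 1 := by
    exact orderOf_dvd_iff_pow_eq_one.mp hordX.dvd
  -- A lift of an element of order `p` has trace `2` or `-2`; the sign of the lift is free.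
  obtain ⟨X', hX', htr⟩ : ∃ X' : SL(2, ZMod p),
      (QuotientGroup.mk X' : PSL(2, ZMod p)) = QuotientGroup.mk X ∧
      trace (X' : Matrix (Fin 2) (Fin 2) (ZMod p)) = 2 := by
    rw [← QuotientGroup.mk_pow, mk_eq_one_iff] at hXp
    rcases hXp with h | h
    · refine ⟨X, rfl, ?_⟩
      rw [trace_eq_of_pow_char_eq (ε := 1) (by ring) (by rw [← coe_pow, h]; simp)]
      ring
    · refine ⟨-X, mk_neg X, ?_⟩
      rw [coe_neg, trace_neg,
        trace_eq_of_pow_char_eq (ε := -1) (by ring) (by rw [← coe_pow, h]; simp)]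
      ring
  have hΓ : H.comap (QuotientGroup.mk' (Subgroup.center SL(2, ZMod p))) = ⊤ := by
    refine eq_top_of_trace_eq_two (X := X') (Y := Y) (Z := Z) ?_ ?_ htr hY hZ hYZ ?_
    · rw [← hX'] at hXH
      exact hXH
    · rintro rfl
      exact hXne hX'.symm
    · intro x y hx
      exact ⟨(y / x).val, by rw [ZMod.natCast_zmod_val, div_mul_cancel₀ _ hx]⟩
  rw [Subgroup.eq_top_iff']
  intro k
  obtain ⟨K, rfl⟩ := QuotientGroup.mk_surjective k
  have : K ∈ H.comap (QuotientGroup.mk' (Subgroup.center SL(2, ZMod p))) := hΓ ▸ Subgroup.mem_top K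
  exact this

end Matrix.SpecialLinearGroup

/-! ### Octahedral relations and the normalizer of the Klein set -/

/-- The elements `w`, `a`, `c` satisfy the relations of the standard Coxeter generators of the
octahedral group modulo its centre, which is the symmetric group on four letters. -/
structure IsOctahedralTriple {G : Type*} [Group G] (w a c : G) : Prop where
  w_sq : w ^ 2 = 1
  a_sq : a ^ 2 = 1
  c_sq : c ^ 2 = 1
  wa_sq : (w * a) ^ 2 = 1
  wc_cube : (w * c) ^ 3 = 1
  ca_four : (c * a) ^ 4 = 1
  wac_cube : (w * a * c) ^ 3 = 1

theorem Subgroup.mem_normalizer_of_sq_eq_one {G : Type*} [Group G] {g : G} {S : Set G}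
    (hg : g ^ 2 = 1) (h : ∀ n ∈ S, g * n * g ∈ S) : g ∈ Subgroup.normalizer S := by
  have hgg : g * g = 1 := by rwa [sq] at hg
  have hinv : g⁻¹ = g := inv_eq_of_mul_eq_one_left hgg
  rw [Subgroup.mem_set_normalizer_iff]
  intro n
  rw [hinv]
  refine ⟨h n, fun hn => ?_⟩
  have e : g * (g * n * g) * g = (g * g) * n * (g * g) := by group
  have := h _ hn
  rwa [e, hgg, one_mul, mul_one] at this

namespace IsOctahedralTriple

variable {G : Type*} [Group G] {w a c : G}

/-- The nontrivial elements of the normal Klein four-group generated by `a`. -/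
def kleinSet (w a c : G) : Set G := {a, c * a * c, w * c * a * c * w}

variable (h : IsOctahedralTriple w a c)
include h

theorem ww : w * w = 1 := by rw [← sq, h.w_sq]
theorem aa : a * a = 1 := by rw [← sq, h.a_sq]
theorem cc : c * c = 1 := by rw [← sq, h.c_sq]
theorem w_inv : w⁻¹ = w := inv_eq_of_mul_eq_one_left h.ww
theorem a_inv : a⁻¹ = a := inv_eq_of_mul_eq_one_left h.aa
theorem c_inv : c⁻¹ = c := inv_eq_of_mul_eq_one_left h.cc

theorem commute_w_a : Commute w a := by
  have := h.wa_sq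
  rw [sq, mul_eq_one_iff_eq_inv, _root_.mul_inv_rev, h.w_inv, h.a_inv] at this
  exact this

theorem braid : c * w * c = w * c * w := by
  have e : (w * c) ^ 3 = (w * c * w) * (c * w * c) := by
    simp only [pow_succ, pow_zero, one_mul, mul_assoc]
  have := h.wc_cube
  rw [e, mul_eq_one_iff_eq_inv] at this
  rw [this]
  simp [mul_assoc, h.w_inv, h.c_inv]

theorem a_conj : a * (c * a * c) * a = c * a * c := by
  have e : (c * a) ^ 4 = (c * a * c) * (a * (c * a * c) * a) := by
    simp only [pow_succ, pow_zero, one_mul, mul_assoc]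
  have := h.ca_four
  rw [e, mul_eq_one_iff_eq_inv] at this
  nth_rw 2 [this]
  simp [mul_assoc, h.a_inv, h.c_inv]

theorem w_mem_normalizer : w ∈ Subgroup.normalizer (kleinSet w a c) := by
  refine Subgroup.mem_normalizer_of_sq_eq_one h.w_sq ?_
  rintro n (rfl | rfl | rfl)
  · left
    rw [h.commute_w_a.eq, mul_assoc, h.ww, mul_one]
  · right; right
    simp [mul_assoc]
  · right; left
    rw [show w * (w * c * a * c * w) * w = (w * w) * (c * a * c) * (w * w) by group, h.ww, one_mul,
      mul_one]

theorem c_mem_normalizer : c ∈ Subgroup.normalizer (kleinSet w a c) := by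
  refine Subgroup.mem_normalizer_of_sq_eq_one h.c_sq ?_
  rintro n (rfl | rfl | rfl)
  · right; left; rfl
  · left
    rw [show c * (c * a * c) * c = (c * c) * a * (c * c) by group, h.cc, one_mul, mul_one]
  · right; right
    rw [show c * (w * c * a * c * w) * c = (c * w * c) * a * (c * w * c) by group, h.braid,
      show w * c * w * a * (w * c * w) = w * c * (w * a * w) * c * w by group, h.commute_w_a.eq,
      mul_assoc a, h.ww, mul_one]
    rfl

theorem a_mem_normalizer : a ∈ Subgroup.normalizer (kleinSet w a c) := by
  refine Subgroup.mem_normalizer_of_sq_eq_one h.a_sq ?_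
  rintro n (rfl | rfl | rfl)
  · left; rw [h.aa, one_mul]
  · right; left; exact h.a_conj
  · right; right
    rw [show a * (w * c * a * c * w) * a = (a * w) * (c * a * c) * (w * a) by group,
      ← h.commute_w_a.eq]
    nth_rw 2 [h.commute_w_a.eq]
    rw [show w * a * (c * a * c) * (a * w) = w * (a * (c * a * c) * a) * w by group, h.a_conj]
    simp [mul_assoc]

/-- The relation `(w * a * c) ^ 3 = 1` has odd length 9: after the leading `w`, the other eight
letters pair up into elements of `H`. -/
theorem w_mem {H : Subgroup G} (hwa : w * a ∈ H) (hwc : w * c ∈ H) : w ∈ H := by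
  have hac : a * c ∈ H := by
    have := H.mul_mem (H.inv_mem hwa) hwc
    rwa [_root_.mul_inv_rev, mul_assoc, inv_mul_cancel_left, h.a_inv] at this
  have hcw : c * w ∈ H := by
    have := H.inv_mem hwc
    rwa [_root_.mul_inv_rev, h.c_inv, h.w_inv] at this
  have e : (w * a * c) ^ 3 = w * (a * c * (w * a) * (c * w) * (a * c)) := by
    simp only [pow_succ, pow_zero, one_mul, mul_assoc]
  have := h.wac_cube
  rw [e, mul_eq_one_iff_eq_inv] at this
  rw [this]
  exact H.inv_mem (H.mul_mem (H.mul_mem (H.mul_mem hac hwa) hcw) hac)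

end IsOctahedralTriple

/-- If all entries of `g` but the `j`-th lie in a proper subgroup containing `w`, for every `j`,
then no entry of `g` can be omitted or replaced by `w`. -/
theorem not_generates_of_forall_mem {G : Type*} [Group G] {k : ℕ} {g : Fin k → G} {w : G}
    {K : Fin k → Subgroup G} (hK : ∀ j, K j ≠ ⊤) (hw : ∀ j, w ∈ K j)
    (hg : ∀ j l, l ≠ j → g l ∈ K j) :
    (∀ j, Subgroup.closure (g '' {l | l ≠ j}) ≠ ⊤) ∧ ¬ CanReplaceSomeEntry g w := by
  refine ⟨fun j htop => hK j ?_, fun ⟨j, htop⟩ => hK j ?_⟩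
  · rw [eq_top_iff, ← htop, Subgroup.closure_le]
    rintro _ ⟨l, hl, rfl⟩
    exact hg j l hl
  · rw [GeneratesGroup] at htop
    rw [eq_top_iff, ← htop, Subgroup.closure_le]
    rintro _ ⟨l, rfl⟩
    by_cases hl : l = j
    · subst hl
      rw [Function.update_self]
      exact hw l
    · rw [Function.update_of_ne hl]
      exact hg j l hl

/-! ### The explicit matrices -/

namespace Matrix.SpecialLinearGroup

section Field

variable {F : Type*} [Field F]

/-- The matrix `!![r, s; s, -r]` with `r = κ (2 i ζ - 1)` and `s = κ (2 i + ζ)`. -/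
def octMatrix (i ζ κ : F) : Matrix (Fin 2) (Fin 2) F :=
  !![κ * (2 * i * ζ - 1), κ * (2 * i + ζ); κ * (2 * i + ζ), -(κ * (2 * i * ζ - 1))]

theorem det_octMatrix {i ζ κ : F} (hi : i ^ 2 = -1) (hζ : ζ ^ 2 = 2) (hκ : 3 * κ = 1) :
    (octMatrix i ζ κ).det = 1 := by
  simp only [octMatrix, det_fin_two_of]
  grind

variable {i ζ κ : F} {W A B C : SL(2, F)}

theorem isOctahedralTriple (hi : i ^ 2 = -1) (hζ : ζ ^ 2 = 2) (hκ : 3 * κ = 1)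
    (hW : (W : Matrix (Fin 2) (Fin 2) F) = !![0, -1; 1, 0])
    (hA : (A : Matrix (Fin 2) (Fin 2) F) = octMatrix i ζ κ)
    (hC : (C : Matrix (Fin 2) (Fin 2) F) = !![-i, 0; -1, i]) :
    IsOctahedralTriple (QuotientGroup.mk W : PSL(2, F)) (QuotientGroup.mk A)
      (QuotientGroup.mk C) := by
  constructor
  · apply mk_sq_eq_one
    simp [hW, trace_fin_two]
  · apply mk_sq_eq_one
    simp [hA, octMatrix, trace_fin_two]
  · apply mk_sq_eq_one
    simp [hC, trace_fin_two]
  · rw [← QuotientGroup.mk_mul]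
    apply mk_sq_eq_one
    simp [hW, hA, octMatrix, trace_fin_two]
  · rw [← QuotientGroup.mk_mul]
    apply mk_pow_three_eq_one
    simp [hW, hC, trace_fin_two]
  · rw [← QuotientGroup.mk_mul]
    apply mk_pow_four_eq_one
    simp [hA, hC, octMatrix, trace_fin_two]
    grind
  · rw [← QuotientGroup.mk_mul, ← QuotientGroup.mk_mul]
    apply mk_pow_three_eq_one
    simp [hW, hA, hC, octMatrix, trace_fin_two]
    grind

theorem trace_mul_octMatrix (hi : i ^ 2 = -1) (hκ : 3 * κ = 1)
    (hA : (A : Matrix (Fin 2) (Fin 2) F) = octMatrix i ζ κ)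
    (hC : (C : Matrix (Fin 2) (Fin 2) F) = !![-i, 0; -1, i]) :
    trace ((C * A : SL(2, F)) : Matrix (Fin 2) (Fin 2) F) = ζ := by
  simp [hA, hC, octMatrix, trace_fin_two]
  grind

theorem trace_sq (X : SL(2, F)) : trace ((X ^ 2 : SL(2, F)) : Matrix (Fin 2) (Fin 2) F) =
    trace (X : Matrix (Fin 2) (Fin 2) F) ^ 2 - 2 := by
  rw [coe_pow, sq_eq_trace_smul_sub_one, trace_sub, trace_smul, smul_eq_mul, ← sq, trace_one]
  simp

theorem orderOf_mk_mul_eq_four (h2 : (2 : F) ≠ 0) (hi : i ^ 2 = -1) (hζ : ζ ^ 2 = 2)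
    (hκ : 3 * κ = 1)
    (hA : (A : Matrix (Fin 2) (Fin 2) F) = octMatrix i ζ κ)
    (hC : (C : Matrix (Fin 2) (Fin 2) F) = !![-i, 0; -1, i]) :
    orderOf (QuotientGroup.mk (C * A) : PSL(2, F)) = 4 := by
  have htr := trace_mul_octMatrix hi hκ hA hC
  refine orderOf_eq_prime_pow (p := 2) (n := 1) ?_ ?_
  · intro h
    rw [pow_one, ← QuotientGroup.mk_pow] at h
    have := trace_eq_or_of_mk_eq (Y := 1) h
    rw [trace_sq, htr, hζ, coe_one, trace_one, sub_self] at this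
    rcases this with h | h
    · exact h2 (by simpa using h.symm)
    · exact h2 (by simpa using h.symm)
  · exact mk_pow_four_eq_one (by rw [htr, hζ])

theorem det_commutator_sq (hi : i ^ 2 = -1) (hζ : ζ ^ 2 = 2) (hκ : 3 * κ = 1)
    (hW : (W : Matrix (Fin 2) (Fin 2) F) = !![0, -1; 1, 0])
    (hA : (A : Matrix (Fin 2) (Fin 2) F) = octMatrix i ζ κ)
    (hC : (C : Matrix (Fin 2) (Fin 2) F) = !![-i, 0; -1, i]) :
    Matrix.det (((W * C) ^ 2 : SL(2, F)) * ((C * A) ^ 2 : SL(2, F)) -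
      ((C * A) ^ 2 : SL(2, F)) * ((W * C) ^ 2 : SL(2, F)) : Matrix (Fin 2) (Fin 2) F) = 2 := by
  have h1 : (((W * C) ^ 2 : SL(2, F)) : Matrix (Fin 2) (Fin 2) F) = !![0, -i; -i, -1] := by
    rw [coe_pow, coe_mul, hW, hC]
    ext j k
    fin_cases j <;> fin_cases k <;> simp [sq] <;> grind
  have h2 : (((C * A) ^ 2 : SL(2, F)) : Matrix (Fin 2) (Fin 2) F) =
      !![κ * (1 + i * ζ), κ * (2 * ζ - 2 * i); κ * (-ζ - 2 * i), -(κ * (1 + i * ζ))] := by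
    rw [coe_pow, sq_eq_trace_smul_sub_one, trace_mul_octMatrix hi hκ hA hC, coe_mul, hC, hA,
      octMatrix]
    ext j k
    fin_cases j <;> fin_cases k <;> simp <;> grind
  rw [h1, h2]
  simp [det_fin_two]
  grind

/-- If `b` normalized the set, `(b * a) ^ 2` would be the product of one of its members with `a`,
with trace `±2` or `0`. Its trace is `±14/9`, which differs from these unless 2 or 7 vanishes. -/
theorem notMem_normalizer_kleinSet (hi : i ^ 2 = -1) (hζ : ζ ^ 2 = 2) (hκ : 3 * κ = 1)
    (h2 : (2 : F) ≠ 0) (h7 : (7 : F) ≠ 0)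
    (hW : (W : Matrix (Fin 2) (Fin 2) F) = !![0, -1; 1, 0])
    (hA : (A : Matrix (Fin 2) (Fin 2) F) = octMatrix i ζ κ)
    (hB : (B : Matrix (Fin 2) (Fin 2) F) = octMatrix i (-ζ) κ)
    (hC : (C : Matrix (Fin 2) (Fin 2) F) = !![-i, 0; -1, i]) :
    (QuotientGroup.mk B : PSL(2, F)) ∉ Subgroup.normalizer (IsOctahedralTriple.kleinSet
      (QuotientGroup.mk W : PSL(2, F)) (QuotientGroup.mk A) (QuotientGroup.mk C)) := by
  intro hmem
  have hBB := (isOctahedralTriple hi (by rwa [neg_sq]) hκ hW hB hC).a_inv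
  have htr : 9 * trace (((B * A) ^ 2 : SL(2, F)) : Matrix (Fin 2) (Fin 2) F) = -14 := by
    rw [trace_sq]
    have : 3 * trace ((B * A : SL(2, F)) : Matrix (Fin 2) (Fin 2) F) = 2 := by
      simp [hA, hB, octMatrix, trace_fin_two]
      grind
    linear_combination (3 * trace ((B * A : SL(2, F)) : Matrix (Fin 2) (Fin 2) F) + 2) * this
  have key : ∀ Y : SL(2, F), (QuotientGroup.mk B : PSL(2, F)) * QuotientGroup.mk A *
      (QuotientGroup.mk B)⁻¹ = QuotientGroup.mk Y →
      trace ((Y * A : SL(2, F)) : Matrix (Fin 2) (Fin 2) F) ≠ -2 ∧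
      trace ((Y * A : SL(2, F)) : Matrix (Fin 2) (Fin 2) F) ≠ 0 := by
    intro Y hY
    have e : (QuotientGroup.mk ((B * A) ^ 2) : PSL(2, F)) = QuotientGroup.mk (Y * A) := by
      rw [QuotientGroup.mk_mul, ← hY, hBB, sq]
      simp only [QuotientGroup.mk_mul, mul_assoc]
    have h14 : (14 : F) ≠ 0 := by
      rw [show (14 : F) = 2 * 7 by norm_num]
      exact mul_ne_zero h2 h7
    have h4 : (4 : F) ≠ 0 := by
      rw [show (4 : F) = 2 * 2 by norm_num]
      exact mul_ne_zero h2 h2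
    have h32 : (32 : F) ≠ 0 := by
      rw [show (32 : F) = 2 ^ 5 by norm_num]
      exact pow_ne_zero _ h2
    constructor <;> intro h0 <;> rcases trace_eq_or_of_mk_eq e with h | h <;>
      rw [h, h0] at htr
    · exact h4 (by linear_combination -htr)
    · exact h32 (by linear_combination htr)
    · exact h14 (by linear_combination htr)
    · exact h14 (by linear_combination htr)
  have hconj := (Subgroup.mem_set_normalizer_iff.mp hmem (QuotientGroup.mk A)).mp (.inl rfl)
  rcases hconj with h | h | h
  · refine (key A h).1 ?_
    simp [hA, octMatrix, trace_fin_two]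
    grind
  · refine (key (C * A * C) h).2 ?_
    rw [mul_assoc, ← sq, trace_sq, trace_mul_octMatrix hi hκ hA hC, hζ, sub_self]
  · refine (key (W * C * A * C * W) h).2 ?_
    simp [hW, hA, hC, octMatrix, trace_fin_two]
    grind

theorem notMem_centralizer (hW : (W : Matrix (Fin 2) (Fin 2) F) = !![0, -1; 1, 0])
    (hC : (C : Matrix (Fin 2) (Fin 2) F) = !![-i, 0; -1, i]) :
    (QuotientGroup.mk C : PSL(2, F)) ∉
      Subgroup.centralizer {(QuotientGroup.mk W : PSL(2, F))} := by
  intro hmem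
  rw [Subgroup.mem_centralizer_singleton_iff, ← QuotientGroup.mk_mul, ← QuotientGroup.mk_mul,
    mk_eq_mk_iff] at hmem
  rcases hmem with h | h
  · have := congrArg (fun X : SL(2, F) => (X : Matrix (Fin 2) (Fin 2) F) 0 0) h
    simp [hW, hC] at this
  · have := congrArg (fun X : SL(2, F) => (X : Matrix (Fin 2) (Fin 2) F) 0 0) h
    simp [hW, hC] at this

end Field

/-! ### Generation, irredundancy and failure of replacement -/

section ZMod

variable {p : ℕ} [Fact p.Prime]

theorem eq_top_of_mem (hp2 : p ≠ 2) {i ζ κ : ZMod p} {W A B C : SL(2, ZMod p)}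
    (hi : i ^ 2 = -1) (hζ : ζ ^ 2 = 2) (hκ : 3 * κ = 1)
    (h2 : (2 : ZMod p) ≠ 0) (h7 : (7 : ZMod p) ≠ 0)
    (hW : (W : Matrix (Fin 2) (Fin 2) (ZMod p)) = !![0, -1; 1, 0])
    (hA : (A : Matrix (Fin 2) (Fin 2) (ZMod p)) = octMatrix i ζ κ)
    (hB : (B : Matrix (Fin 2) (Fin 2) (ZMod p)) = octMatrix i (-ζ) κ)
    (hC : (C : Matrix (Fin 2) (Fin 2) (ZMod p)) = !![-i, 0; -1, i])
    {H : Subgroup PSL(2, ZMod p)} (hwH : QuotientGroup.mk W ∈ H) (haH : QuotientGroup.mk A ∈ H)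
    (hbH : QuotientGroup.mk B ∈ H) (hcH : QuotientGroup.mk C ∈ H) : H = ⊤ := by
  have hoct := isOctahedralTriple hi hζ hκ hW hA hC
  have hdet := det_commutator_sq hi hζ hκ hW hA hC
  have hord := orderOf_mk_mul_eq_four h2 hi hζ hκ hA hC
  by_cases hdvd : p ∣ Nat.card H
  · exact eq_top_of_char_dvd_card (Y := (W * C) ^ 2) (Z := (C * A) ^ 2) hdvd
      (H.pow_mem (H.mul_mem hwH hcH) 2) (H.pow_mem (H.mul_mem hcH haH) 2) (by rwa [hdet])
  · exfalso
    -- Stated for every `K ≤ H` so that it serves for `H` and for `H ⊓ N`.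
    have card_eq : ∀ K : Subgroup PSL(2, ZMod p), K ≤ H → QuotientGroup.mk W ∈ K →
        QuotientGroup.mk A ∈ K → QuotientGroup.mk C ∈ K → Nat.card K = 24 :=
      fun K hK hw ha hc => card_eq_twentyFour_of_coprime hp2
        (fun h => hdvd (h.trans (Subgroup.card_dvd_of_le hK))) (K.mul_mem hc ha)
        (Y := W * C) (Z := C * A) (K.mul_mem hw hc) (K.mul_mem hc ha) hord (by rwa [hdet])
    let N := Subgroup.normalizer (IsOctahedralTriple.kleinSet
      (QuotientGroup.mk W : PSL(2, ZMod p)) (QuotientGroup.mk A) (QuotientGroup.mk C))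
    have hle : H ⊓ N ≤ H := inf_le_left
    have h24 := card_eq (H ⊓ N) hle ⟨hwH, hoct.w_mem_normalizer⟩ ⟨haH, hoct.a_mem_normalizer⟩
      ⟨hcH, hoct.c_mem_normalizer⟩
    have h24' := card_eq H le_rfl hwH haH hcH
    have := Nat.finite_of_card_ne_zero (α := H) (by rw [h24']; decide)
    have heq : H ⊓ N = H := Subgroup.eq_of_le_of_card_ge hle (by rw [h24, h24'])
    refine notMem_normalizer_kleinSet hi hζ hκ h2 h7 hW hA hB hC ?_
    exact inf_le_right (a := H) (b := N) (heq.symm ▸ hbH)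

end ZMod

variable {p : ℕ} [Fact p.Prime]

theorem natCast_ne_zero_of_prime {q : ℕ} (hq : q.Prime) (hpq : p ≠ q) : (q : ZMod p) ≠ 0 := by
  rw [Ne, ZMod.natCast_eq_zero_iff, Nat.prime_dvd_prime_iff_eq Fact.out hq]
  exact hpq

theorem isIrredundantGenerating_octahedral (hp2 : p ≠ 2) (hp3 : p ≠ 3) (hp7 : p ≠ 7)
    {i ζ s r u t : ZMod p} (hi : i ^ 2 = -1) (hζ : ζ ^ 2 = 2)
    (hs : s = (2 * i + ζ) / 3) (hr : r = (i + 1 / ζ) * s)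
    (hu : u = (2 * i - ζ) / 3) (ht : t = (i - 1 / ζ) * u) :
    ∃ W A B C : SL(2, ZMod p),
      (W : Matrix (Fin 2) (Fin 2) (ZMod p)) = !![0, -1; 1, 0] ∧
      (A : Matrix (Fin 2) (Fin 2) (ZMod p)) = !![r, s; s, -r] ∧
      (B : Matrix (Fin 2) (Fin 2) (ZMod p)) = !![t, u; u, -t] ∧
      (C : Matrix (Fin 2) (Fin 2) (ZMod p)) = !![-i, 0; -1, i] ∧
      ∃ w a b c : PSL(2, ZMod p),
        w = QuotientGroup.mk W ∧ a = QuotientGroup.mk A ∧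
        b = QuotientGroup.mk B ∧ c = QuotientGroup.mk C ∧
        w ≠ 1 ∧
        IsIrredundantGenerating ![w * a, w * b, w * c] ∧
        ¬ CanReplaceSomeEntry ![w * a, w * b, w * c] w := by
  have h2 : (2 : ZMod p) ≠ 0 := by exact_mod_cast natCast_ne_zero_of_prime Nat.prime_two hp2
  have h3 : (3 : ZMod p) ≠ 0 := by exact_mod_cast natCast_ne_zero_of_prime Nat.prime_three hp3
  have h7 : (7 : ZMod p) ≠ 0 := by
    exact_mod_cast natCast_ne_zero_of_prime (by norm_num : Nat.Prime 7) hp7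
  have hζ0 : ζ ≠ 0 := by
    rintro rfl
    exact h2 (by rw [← hζ]; ring)
  obtain ⟨κ, hκ⟩ : ∃ κ : ZMod p, 3 * κ = 1 := ⟨3⁻¹, mul_inv_cancel₀ h3⟩
  obtain ⟨z, hz⟩ : ∃ z : ZMod p, ζ * z = 1 := ⟨ζ⁻¹, mul_inv_cancel₀ hζ0⟩
  have hdiv3 : ∀ x : ZMod p, x / 3 = κ * x := fun x => by
    rw [div_eq_iff h3]; linear_combination -x * hκ
  have hdivζ : 1 / ζ = z := by rw [div_eq_iff hζ0]; linear_combination -hz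
  have hζ' : (-ζ) ^ 2 = 2 := by rw [neg_sq, hζ]
  have hz2 : 2 * z = ζ := by linear_combination -z * hζ + ζ * hz
  rw [hdiv3] at hs hu
  rw [hdivζ] at hr ht
  have hAm : !![r, s; s, -r] = octMatrix i ζ κ := by
    have : r = κ * (2 * i * ζ - 1) := by
      rw [hr, hs]
      linear_combination 2 * κ * hi + κ * i * hz2 + κ * hz
    rw [octMatrix, this, hs]
  have hBm : !![t, u; u, -t] = octMatrix i (-ζ) κ := by
    have : t = κ * (2 * i * (-ζ) - 1) := by
      rw [ht, hu]
      linear_combination 2 * κ * hi - κ * i * hz2 + κ * hz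
    rw [octMatrix, this, hu, sub_eq_add_neg (2 * i)]
  rw [hAm, hBm]
  let W : SL(2, ZMod p) := ⟨!![0, -1; 1, 0], by simp⟩
  let A : SL(2, ZMod p) := ⟨octMatrix i ζ κ, det_octMatrix hi hζ hκ⟩
  let B : SL(2, ZMod p) := ⟨octMatrix i (-ζ) κ, det_octMatrix hi hζ' hκ⟩
  let C : SL(2, ZMod p) := ⟨!![-i, 0; -1, i], by
    rw [det_fin_two_of]; linear_combination -hi⟩
  have hW : (W : Matrix (Fin 2) (Fin 2) (ZMod p)) = !![0, -1; 1, 0] := rfl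
  have hA : (A : Matrix (Fin 2) (Fin 2) (ZMod p)) = octMatrix i ζ κ := rfl
  have hB : (B : Matrix (Fin 2) (Fin 2) (ZMod p)) = octMatrix i (-ζ) κ := rfl
  have hC : (C : Matrix (Fin 2) (Fin 2) (ZMod p)) = !![-i, 0; -1, i] := rfl
  clear_value W A B C
  refine ⟨W, A, B, C, hW, hA, hB, hC, QuotientGroup.mk W, QuotientGroup.mk A,
    QuotientGroup.mk B, QuotientGroup.mk C, rfl, rfl, rfl, rfl, ?_, ?_⟩
  · intro h
    rcases mk_eq_one_iff.mp h with h | h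
    · have := congrArg (fun X : SL(2, ZMod p) => (X : Matrix (Fin 2) (Fin 2) (ZMod p)) 1 0) h
      simp [hW] at this
    · have := congrArg (fun X : SL(2, ZMod p) => (X : Matrix (Fin 2) (Fin 2) (ZMod p)) 1 0) h
      simp [hW] at this
  have hoctA := isOctahedralTriple hi hζ hκ hW hA hC
  have hoctB := isOctahedralTriple hi hζ' hκ hW hB hC
  have hbN := notMem_normalizer_kleinSet hi hζ hκ h2 h7 hW hA hB hC
  have haN := notMem_normalizer_kleinSet hi hζ' hκ h2 h7 hW hB (by rw [neg_neg, hA]) hC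
  have hcZ := notMem_centralizer hW hC
  have htop : ∀ {H : Subgroup PSL(2, ZMod p)}, QuotientGroup.mk W ∈ H → QuotientGroup.mk A ∈ H →
      QuotientGroup.mk B ∈ H → QuotientGroup.mk C ∈ H → H = ⊤ :=
    eq_top_of_mem hp2 hi hζ hκ h2 h7 hW hA hB hC
  generalize (QuotientGroup.mk W : PSL(2, ZMod p)) = w at *
  generalize (QuotientGroup.mk A : PSL(2, ZMod p)) = a at *
  generalize (QuotientGroup.mk B : PSL(2, ZMod p)) = b at *
  generalize (QuotientGroup.mk C : PSL(2, ZMod p)) = c at *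
  have hwZ : w ∈ Subgroup.centralizer {w} := Subgroup.mem_centralizer_singleton_iff.mpr rfl
  have haZ : a ∈ Subgroup.centralizer {w} :=
    Subgroup.mem_centralizer_singleton_iff.mpr hoctA.commute_w_a.eq.symm
  have hbZ : b ∈ Subgroup.centralizer {w} :=
    Subgroup.mem_centralizer_singleton_iff.mpr hoctB.commute_w_a.eq.symm
  have hproper := not_generates_of_forall_mem (g := ![w * a, w * b, w * c]) (w := w)
    (K := ![Subgroup.normalizer (IsOctahedralTriple.kleinSet w b c),
      Subgroup.normalizer (IsOctahedralTriple.kleinSet w a c), Subgroup.centralizer {w}])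
    (by
      intro j
      fin_cases j
      · exact fun h => haN ((Subgroup.eq_top_iff' _).mp h _)
      · exact fun h => hbN ((Subgroup.eq_top_iff' _).mp h _)
      · exact fun h => hcZ ((Subgroup.eq_top_iff' _).mp h _))
    (by
      intro j
      fin_cases j
      · exact hoctB.w_mem_normalizer
      · exact hoctA.w_mem_normalizer
      · exact hwZ)
    (by
      intro j l hl
      fin_cases j <;> fin_cases l
      · exact absurd rfl hl
      · exact mul_mem hoctB.w_mem_normalizer hoctB.a_mem_normalizer
      · exact mul_mem hoctB.w_mem_normalizer hoctB.c_mem_normalizer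
      · exact mul_mem hoctA.w_mem_normalizer hoctA.a_mem_normalizer
      · exact absurd rfl hl
      · exact mul_mem hoctA.w_mem_normalizer hoctA.c_mem_normalizer
      · exact mul_mem hwZ haZ
      · exact mul_mem hwZ hbZ
      · exact absurd rfl hl)
  refine ⟨⟨?_, hproper.1⟩, hproper.2⟩
  have hmem : ∀ j, ![w * a, w * b, w * c] j ∈
      Subgroup.closure (Set.range ![w * a, w * b, w * c]) :=
    fun j => Subgroup.subset_closure ⟨j, rfl⟩
  have hw := hoctA.w_mem (hmem 0) (hmem 2)
  exact htop hw ((Subgroup.mul_mem_cancel_left _ hw).mp (hmem 0))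
    ((Subgroup.mul_mem_cancel_left _ hw).mp (hmem 1))
    ((Subgroup.mul_mem_cancel_left _ hw).mp (hmem 2))

end Matrix.SpecialLinearGroup

end

theorem theorem18 (p : ℕ) [Fact p.Prime] (hp : p ≡ 1 [MOD 8])
    (hm : maxIrredundantLength PSL(2, ZMod p) = 3) :
    ¬ SatisfiesReplacementProperty PSL(2, ZMod p) ∧
    (∃ i : ZMod p, i ^ 2 = -1) ∧ (∃ ζ : ZMod p, ζ ^ 2 = 2) ∧
    ∀ i ζ s r u t : ZMod p, i ^ 2 = -1 → ζ ^ 2 = 2 →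
      s = (2 * i + ζ) / 3 → r = (i + 1 / ζ) * s →
      u = (2 * i - ζ) / 3 → t = (i - 1 / ζ) * u →
      ∃ W A B C : SL(2, ZMod p),
        (W : Matrix (Fin 2) (Fin 2) (ZMod p)) = !![0, -1; 1, 0] ∧
        (A : Matrix (Fin 2) (Fin 2) (ZMod p)) = !![r, s; s, -r] ∧
        (B : Matrix (Fin 2) (Fin 2) (ZMod p)) = !![t, u; u, -t] ∧
        (C : Matrix (Fin 2) (Fin 2) (ZMod p)) = !![-i, 0; -1, i] ∧
        ∃ w a b c : PSL(2, ZMod p),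
          w = QuotientGroup.mk W ∧ a = QuotientGroup.mk A ∧
          b = QuotientGroup.mk B ∧ c = QuotientGroup.mk C ∧
          w ≠ 1 ∧
          IsIrredundantGenerating ![w * a, w * b, w * c] ∧
          ¬ CanReplaceSomeEntry ![w * a, w * b, w * c] w := by
  have hp8 : p % 8 = 1 := hp
  have hp2 : p ≠ 2 := by omega
  obtain ⟨i, hi⟩ : ∃ i : ZMod p, i ^ 2 = -1 := by
    obtain ⟨i, hi⟩ := ZMod.exists_sq_eq_neg_one_iff (p := p).mpr (by omega)
    exact ⟨i, by rw [sq, hi]⟩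
  obtain ⟨ζ, hζ⟩ : ∃ ζ : ZMod p, ζ ^ 2 = 2 := by
    obtain ⟨ζ, hζ⟩ := (ZMod.exists_sq_eq_two_iff hp2).mpr (.inl hp8)
    exact ⟨ζ, by rw [sq, hζ]⟩
  refine ⟨fun hrep => ?_, ⟨i, hi⟩, ⟨ζ, hζ⟩, ?_⟩
  · obtain ⟨W, A, B, C, -, -, -, -, w, a, b, c, -, -, -, -, hw, hgen, hnot⟩ :=
      Matrix.SpecialLinearGroup.isIrredundantGenerating_octahedral hp2 (by omega) (by omega) hi hζ
        rfl rfl rfl rfl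
    -- By `hm` the triple has maximal length, so the replacement property applies to it.
    exact hnot (hrep 3 _ (by rw [hm]; rfl) hgen w hw)
  · intro i ζ s r u t hi hζ hs hr hu ht
    exact Matrix.SpecialLinearGroup.isIrredundantGenerating_octahedral hp2 (by omega) (by omega)
      hi hζ hs hr hu ht
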